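/- **Theorem 3.1.** Write $(b;q)_n=\prod_{k=0}^{n-1}(1-bq^k)$, $(b;q)_\infty=\prod_{k=0}^{\infty}(1-bq^k)$ and, for a positive integer $k$, $\ell_k=(q^k;q^k)_\infty$. Let $$v(q)=\sum_{n=0}^{\infty}\frac{q^{(n+1)^2}(-q;q^2)_n}{(q;q^2)_{n+1}}$$ be the eighth order mock theta function, and define the integers $P_v(n)$ by $\sum_{n=0}^{\infty}P_v(n)q^n=v(q)$. Then, as formal power series in $q$ with integer coefficients, $$\sum_{n=0}^{\infty}P_v(2n+1)q^n=\frac{\ell_4^3}{\ell_1\ell_2}.$$ -/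

import Mathlib

open scoped PowerSeries PowerSeries.WithPiTopology

namespace MockTheta

/-- The finite `q`-Pochhammer symbol `(b; q)_n = ∏_{k=0}^{n-1} (1 - b q^k)`. -/
def qPoch {R : Type*} [CommRing R] (b q : R) (n : ℕ) : R :=
  ∏ k ∈ Finset.range n, (1 - b * q ^ k)

/-- The infinite `q`-Pochhammer symbol `(b; q)_∞ = ∏_{k≥0} (1 - b q^k)`. -/
noncomputable def qPochInf {R : Type*} [CommRing R] [TopologicalSpace R] (b q : R) : R :=
  ∏' k : ℕ, (1 - b * q ^ k)

/-- `ℓ_k = (q^k; q^k)_∞` as a formal power series in `q = X` with integer coefficients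
(convergence is coefficientwise; the topology on `ℤ` is the discrete one). -/
noncomputable def ell (k : ℕ) : ℤ⟦X⟧ :=
  qPochInf (PowerSeries.X ^ k : ℤ⟦X⟧) (PowerSeries.X ^ k)

/-- The reciprocal `1 / f` of a formal power series with constant term `1`;
it is only used for such series. -/
noncomputable def recip (f : ℤ⟦X⟧) : ℤ⟦X⟧ := PowerSeries.invOfUnit f 1

/-- The `n`-th summand `q^{(n+1)^2} (-q; q^2)_n / (q; q^2)_{n+1}` of `v(q)`. -/
noncomputable def vTerm (n : ℕ) : ℤ⟦X⟧ :=
  PowerSeries.X ^ ((n + 1) ^ 2) * qPoch (-PowerSeries.X) (PowerSeries.X ^ 2) n *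
    recip (qPoch PowerSeries.X (PowerSeries.X ^ 2) (n + 1))

/-- The eighth order mock theta function
`v(q) = ∑_{n≥0} q^{(n+1)^2} (-q; q^2)_n / (q; q^2)_{n+1}`, as a formal power series. -/
noncomputable def v : ℤ⟦X⟧ := ∑' n : ℕ, vTerm n

/-- The coefficients of `v(q) = ∑_{n≥0} P_v(n) q^n`. -/
noncomputable def Pv (n : ℕ) : ℤ := PowerSeries.coeff n v

/-! The sum, the products and the reciprocals above are genuine. -/

theorem mul_recip {f : ℤ⟦X⟧} (hf : PowerSeries.constantCoeff f = 1) : f * recip f = 1 :=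
  PowerSeries.mul_invOfUnit f 1 (by simpa using hf)

theorem constantCoeff_qPoch (n : ℕ) : PowerSeries.constantCoeff
    (qPoch (PowerSeries.X : ℤ⟦X⟧) (PowerSeries.X ^ 2) n) = 1 := by
  simp [qPoch, map_prod]

theorem summable_vTerm : Summable vTerm := by
  rw [PowerSeries.WithPiTopology.summable_iff_summable_coeff]
  intro d
  refine summable_of_hasFiniteSupport ((Set.finite_Iio (d + 1)).subset fun n hn => ?_)
  by_contra h
  apply hn
  have hd : d < (n + 1) ^ 2 := by
    simp only [Set.mem_Iio, not_lt] at h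
    nlinarith
  simp only [vTerm, mul_assoc]
  rw [PowerSeries.coeff_X_pow_mul', if_neg (by omega)]

theorem multipliable_ell {k : ℕ} (hk : 0 < k) :
    Multipliable fun n : ℕ => (1 - PowerSeries.X ^ k * (PowerSeries.X ^ k) ^ n : ℤ⟦X⟧) := by
  have h : Filter.Tendsto (fun n : ℕ => (-(PowerSeries.X ^ k * (PowerSeries.X ^ k) ^ n) :
      ℤ⟦X⟧).order) Filter.atTop (nhds ⊤) := by
    refine ENat.tendsto_nhds_top_iff_natCast_lt.mpr fun n => Filter.eventually_atTop.mpr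
      ⟨n, fun m hm => ?_⟩
    rw [PowerSeries.order_neg, ← pow_succ', ← pow_mul, PowerSeries.order_X_pow]
    exact_mod_cast (by nlinarith : n < k * (m + 1))
  simpa [sub_eq_add_neg] using
    PowerSeries.WithPiTopology.multipliable_one_add_of_tendsto_order_atTop_nhds_top ℤ h

theorem constantCoeff_ell {k : ℕ} (hk : 0 < k) : PowerSeries.constantCoeff (ell k) = 1 := by
  have h := (multipliable_ell hk).map_tprod (PowerSeries.constantCoeff (R := ℤ))
    (PowerSeries.WithPiTopology.continuous_constantCoeff ℤ)
  rw [ell, qPochInf, h]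
  simp [hk.ne']

end MockTheta

namespace MockTheta

open PowerSeries Filter Topology

/-! Multiplying `v` by the even series (-q;q²)_∞ (q;q²)_∞ clears denominators and leaves q S_0,
where S_0 is the first member of the family S_N = `contigSum N`. So the odd part of `v` comes from
the even part of S_0.

A telescoping certificate gives S_N = (1 + q^(4N+4)) S_(N+1) + q^(2N+1) (-q^(2N+3);q²)_∞
(q^(2N+3);q²)_∞ (`contigSum_eq`). The last term is odd, since q ↦ -q swaps the two products, so it
drops out of even parts. As N → ∞, S_N tends to the even series Σ q^(2n²+2n); hence the even part of
S_0 is (-q⁴;q⁴)_∞ Σ q^(2n²+2n) (`contigSum_zero_add_rescale_eq_tsum`).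

Replacing q² by q yields `mk_Pv_mul`. Gauss's Σ q^(n²+n) = (q⁴;q⁴)_∞ / (q²;q⁴)_∞, proved by Shanks'
finite identity, and elementary relations between ℓ_1, ℓ_2, ℓ_4 finish the proof. -/

theorem eq_of_forall_X_pow_dvd_sub {f g : ℤ⟦X⟧} (h : ∀ m, (X : ℤ⟦X⟧) ^ m ∣ f - g) : f = g := by
  ext d
  have := X_pow_dvd_iff.mp (h (d + 1)) d (Nat.lt_succ_self d)
  rwa [map_sub, sub_eq_zero] at this

theorem X_pow_dvd_of_tendsto {f : ℕ → ℤ⟦X⟧} {g : ℤ⟦X⟧} {m : ℕ} (hf : Tendsto f atTop (𝓝 g))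
    (h : ∀ᶠ n in atTop, (X : ℤ⟦X⟧) ^ m ∣ f n) : (X : ℤ⟦X⟧) ^ m ∣ g := by
  rw [X_pow_dvd_iff]
  intro d hd
  have h1 := (WithPiTopology.tendsto_iff_coeff_tendsto _ _ _ _).mp hf d
  refine tendsto_nhds_unique h1 (tendsto_const_nhds.congr' ?_)
  filter_upwards [h] with n hn
  exact (X_pow_dvd_iff.mp hn d hd).symm

theorem tendsto_of_X_pow_dvd {f : ℕ → ℤ⟦X⟧} {g : ℤ⟦X⟧} (h : ∀ n, (X : ℤ⟦X⟧) ^ n ∣ f n - g) :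
    Tendsto f atTop (𝓝 g) := by
  rw [WithPiTopology.tendsto_iff_coeff_tendsto]
  intro d
  refine tendsto_const_nhds.congr' ?_
  filter_upwards [eventually_gt_atTop d] with n hn
  have := X_pow_dvd_iff.mp (h n) d hn
  rw [map_sub, sub_eq_zero] at this
  exact this.symm

theorem summable_of_X_pow_dvd {f : ℕ → ℤ⟦X⟧} (h : ∀ n, (X : ℤ⟦X⟧) ^ n ∣ f n) : Summable f := by
  rw [WithPiTopology.summable_iff_summable_coeff]
  intro d
  refine summable_of_hasFiniteSupport ((Set.finite_Iio (d + 1)).subset fun n hn => ?_)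
  by_contra hd
  exact hn (X_pow_dvd_iff.mp (h n) d (by simpa using hd))

theorem X_pow_dvd_tsum {f : ℕ → ℤ⟦X⟧} {m : ℕ} (hs : Summable f)
    (h : ∀ n, (X : ℤ⟦X⟧) ^ m ∣ f n) : (X : ℤ⟦X⟧) ^ m ∣ ∑' n, f n :=
  X_pow_dvd_of_tendsto hs.hasSum.tendsto_sum_nat
    (Eventually.of_forall fun _ => Finset.dvd_sum fun n _ => h n)

/-! ### Infinite `q`-Pochhammer symbols of power series -/

theorem multipliable_qPochInf (b : ℤ⟦X⟧) {q : ℤ⟦X⟧} (hq : X ∣ q) :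
    Multipliable fun k : ℕ => 1 - b * q ^ k := by
  have h : Tendsto (fun n : ℕ => (-(b * q ^ n)).order) atTop (𝓝 ⊤) := by
    refine ENat.tendsto_nhds_top_iff_natCast_lt.mpr fun n => eventually_atTop.mpr
      ⟨n + 1, fun m hm => ?_⟩
    have h1 : (m : ℕ∞) ≤ (-(b * q ^ m)).order := by
      rw [order_neg]
      refine nat_le_order _ _ fun i hi => X_pow_dvd_iff.mp ?_ i hi
      exact (pow_dvd_pow_of_dvd hq m).mul_left b
    exact lt_of_lt_of_le (by exact_mod_cast hm) h1
  simpa [sub_eq_add_neg] using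
    WithPiTopology.multipliable_one_add_of_tendsto_order_atTop_nhds_top ℤ h

theorem tendsto_qPoch (b : ℤ⟦X⟧) {q : ℤ⟦X⟧} (hq : X ∣ q) :
    Tendsto (qPoch b q) atTop (𝓝 (qPochInf b q)) :=
  (multipliable_qPochInf b hq).hasProd.tendsto_prod_nat

theorem qPochInf_eq_mul_succ (b : ℤ⟦X⟧) {q : ℤ⟦X⟧} (hq : X ∣ q) :
    qPochInf b q = (1 - b) * qPochInf (b * q) q := by
  have h : ∀ k : ℕ, 1 - b * q * q ^ k = 1 - b * q ^ (k + 1) := fun k => by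
    rw [pow_succ', mul_assoc]
  have hm : Multipliable fun k : ℕ => 1 - b * q ^ (k + 1) :=
    (multipliable_congr h).mp (multipliable_qPochInf (b * q) hq)
  have h0 := tprod_eq_zero_mul' (f := fun k : ℕ => 1 - b * q ^ k) hm
  rw [pow_zero, mul_one] at h0
  rw [qPochInf, qPochInf, h0, tprod_congr h]

theorem qPoch_succ {R : Type*} [CommRing R] (b q : R) (n : ℕ) :
    qPoch b q (n + 1) = qPoch b q n * (1 - b * q ^ n) :=
  Finset.prod_range_succ _ _

theorem qPochInf_eq_qPoch_mul (b : ℤ⟦X⟧) {q : ℤ⟦X⟧} (hq : X ∣ q) (n : ℕ) :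
    qPochInf b q = qPoch b q n * qPochInf (b * q ^ n) q := by
  induction n with
  | zero => simp [qPoch]
  | succ n ih =>
    rw [ih, qPochInf_eq_mul_succ (b * q ^ n) hq, qPoch_succ, pow_succ]
    ring_nf

theorem X_pow_dvd_qPochInf_sub_one {b q : ℤ⟦X⟧} (hq : X ∣ q) {m : ℕ} (hb : X ^ m ∣ b) :
    X ^ m ∣ qPochInf b q - 1 := by
  refine X_pow_dvd_of_tendsto ((tendsto_qPoch b hq).sub_const 1) (Eventually.of_forall fun n => ?_)
  induction n with
  | zero => simp [qPoch]
  | succ n ih =>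
    have : qPoch b q (n + 1) - 1 = (qPoch b q n - 1) - b * (qPoch b q n * q ^ n) := by
      rw [qPoch_succ]; ring
    rw [this]
    exact dvd_sub ih (hb.mul_right _)

theorem qPochInf_neg_mul (b : ℤ⟦X⟧) {q : ℤ⟦X⟧} (hq : X ∣ q) :
    qPochInf (-b) q * qPochInf b q = qPochInf (b ^ 2) (q ^ 2) := by
  rw [qPochInf, qPochInf, qPochInf,
    ← (multipliable_qPochInf (-b) hq).tprod_mul (multipliable_qPochInf b hq)]
  exact tprod_congr fun k => by ring

theorem qPochInf_even_mul_odd (b : ℤ⟦X⟧) {q : ℤ⟦X⟧} (hq : X ∣ q) :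
    qPochInf b (q ^ 2) * qPochInf (b * q) (q ^ 2) = qPochInf b q := by
  have hq2 : X ∣ q ^ 2 := hq.trans (dvd_pow_self q two_ne_zero)
  have h0 : (fun k : ℕ => 1 - b * (q ^ 2) ^ k) = fun k => 1 - b * q ^ (2 * k) := by
    ext1 k; rw [pow_mul]
  have h1 : (fun k : ℕ => 1 - b * q * (q ^ 2) ^ k) = fun k => 1 - b * q ^ (2 * k + 1) := by
    ext1 k; rw [← pow_mul, pow_succ']; ring
  have m0 := multipliable_qPochInf b hq2
  have m1 := multipliable_qPochInf (b * q) hq2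
  rw [h0] at m0
  rw [h1] at m1
  rw [qPochInf, qPochInf, qPochInf, h0, h1]
  exact tprod_even_mul_odd (f := fun k => 1 - b * q ^ k) m0 m1

theorem map_qPochInf (φ : ℤ⟦X⟧ →+* ℤ⟦X⟧) (hφ : Continuous φ) (b : ℤ⟦X⟧) {q : ℤ⟦X⟧}
    (hq : X ∣ q) : φ (qPochInf b q) = qPochInf (φ b) (φ q) := by
  rw [qPochInf, (multipliable_qPochInf b hq).map_tprod φ hφ]
  simp [qPochInf]

/-! ### The substitutions `q ↦ -q` and `q ↦ q ^ 2` -/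

theorem continuous_rescale (a : ℤ) : Continuous (rescale a : ℤ⟦X⟧ →+* ℤ⟦X⟧) := by
  refine continuous_iff_continuousAt.mpr fun f => ?_
  refine (WithPiTopology.tendsto_iff_coeff_tendsto _ _ _ _).mpr fun d => ?_
  simp only [coeff_rescale]
  exact ((WithPiTopology.continuous_coeff ℤ d).tendsto f).const_mul _

theorem continuous_expand (p : ℕ) (hp : p ≠ 0) : Continuous (expand p hp : ℤ⟦X⟧ → ℤ⟦X⟧) := by
  refine continuous_iff_continuousAt.mpr fun f => ?_
  refine (WithPiTopology.tendsto_iff_coeff_tendsto _ _ _ _).mpr fun d => ?_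
  simp only [coeff_expand]
  split_ifs
  · exact (WithPiTopology.continuous_coeff ℤ _).tendsto f
  · exact tendsto_const_nhds

theorem expand_injective (p : ℕ) (hp : p ≠ 0) :
    Function.Injective (expand p hp : ℤ⟦X⟧ → ℤ⟦X⟧) := by
  intro f g h
  ext n
  simpa [coeff_expand_mul] using congrArg (coeff (p * n)) h

theorem expand_qPochInf (p : ℕ) (hp : p ≠ 0) (b : ℤ⟦X⟧) {q : ℤ⟦X⟧} (hq : X ∣ q) :
    expand p hp (qPochInf b q) = qPochInf (expand p hp b) (expand p hp q) :=
  map_qPochInf (expand p hp : ℤ⟦X⟧ →ₐ[ℤ] ℤ⟦X⟧).toRingHom (continuous_expand p hp) b hq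

/-- Extracts the odd-indexed coefficients. -/
theorem sub_rescale_neg_one (f : ℤ⟦X⟧) : f - rescale (-1 : ℤ) f =
    2 * X * expand 2 two_ne_zero (PowerSeries.mk fun n => coeff (2 * n + 1) f) := by
  ext d
  rw [mul_assoc, ← map_ofNat (C (R := ℤ)) 2, coeff_C_mul, map_sub, coeff_rescale]
  rcases d with _ | d
  · simp
  · rw [mul_comm X, coeff_succ_mul_X, coeff_expand]
    rcases Nat.even_or_odd' d with ⟨k, rfl | rfl⟩
    · simp [pow_succ]; ring
    · rw [if_neg (by omega)]; simp [pow_succ]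

/-! ### Gauss's theorem on triangular numbers -/

/-- Shanks' telescoping for Gauss's triangular number series; `D` plays the role of the tails
`(q ^ (2 * n + 1); q ^ 2)_∞`. -/
theorem sum_shanks_sub {R : Type*} [CommRing R] (q : R) (D : ℕ → R)
    (hD : ∀ n, D n = (1 - q ^ (2 * n + 1)) * D (n + 1)) (n m : ℕ) (hm : m ≤ n) :
    ∑ k ∈ Finset.range (m + 1),
      (D (n + 1) * qPoch q (q ^ 2) k * (∏ j ∈ Finset.Ico k (n + 1), (1 - q ^ (2 * j + 2))) *
          q ^ (k * (2 * n + 3)) -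
        D n * qPoch q (q ^ 2) k * (∏ j ∈ Finset.Ico k n, (1 - q ^ (2 * j + 2))) *
          q ^ (k * (2 * n + 1))) =
      D (n + 1) * qPoch q (q ^ 2) (m + 1) * (∏ j ∈ Finset.Ico m n, (1 - q ^ (2 * j + 2))) *
        q ^ ((2 * n + 1) * (m + 1)) := by
  induction m with
  | zero =>
    rw [Finset.sum_range_one, Finset.prod_Ico_succ_top (Nat.zero_le n), hD n, qPoch_succ]
    simp only [qPoch, Finset.range_zero, Finset.prod_empty, pow_zero, zero_mul, zero_add, mul_one]
    ring
  | succ m ih =>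
    rw [Finset.sum_range_succ, ih (by omega), Finset.prod_Ico_succ_top hm, hD n,
      Finset.prod_eq_prod_Ico_succ_bot (show m < n by omega), qPoch_succ _ _ (m + 1)]
    ring

/-- Induction on `n`: the increment is `sum_shanks_sub` at `m = n`, plus the new `k = n` summand.
The exponents on the right are the triangular numbers of index 2m and 2m+1. -/
theorem sum_shanks {R : Type*} [CommRing R] (q : R) (D : ℕ → R)
    (hD : ∀ n, D n = (1 - q ^ (2 * n + 1)) * D (n + 1)) (n : ℕ) :
    ∑ k ∈ Finset.range n,
      D n * qPoch q (q ^ 2) k * (∏ j ∈ Finset.Ico k n, (1 - q ^ (2 * j + 2))) *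
        q ^ (k * (2 * n + 1)) =
      D 0 * ∑ m ∈ Finset.range n, (q ^ (m * (2 * m + 1)) + q ^ ((m + 1) * (2 * m + 1))) := by
  have hD0 : ∀ n, D 0 = qPoch q (q ^ 2) n * D n := by
    intro n
    induction n with
    | zero => simp [qPoch]
    | succ n ih => rw [ih, hD n, qPoch_succ]; ring
  induction n with
  | zero => simp
  | succ n ih =>
    have h := sum_shanks_sub q D hD n n le_rfl
    rw [Finset.sum_sub_distrib, Finset.sum_range_succ _ n, Finset.sum_range_succ _ n, ih] at h
    rw [show 2 * (n + 1) + 1 = 2 * n + 3 by ring, Finset.sum_range_succ, Finset.sum_range_succ,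
      mul_add (D 0), mul_add (D 0)]
    simp only [Finset.Ico_self, Finset.prod_empty, mul_one] at h
    have h1 := hD0 n
    have h2 := hD0 (n + 1)
    linear_combination h - q ^ (n * (2 * n + 1)) * h1 -  q ^ ((2 * n + 1) * (n + 1)) * h2

theorem summable_X_pow_sq_add : Summable fun n : ℕ => (X : ℤ⟦X⟧) ^ (n ^ 2 + n) :=
  summable_of_X_pow_dvd fun n => pow_dvd_pow _ (by nlinarith)

theorem qPochInf_mul_tsum_X_pow :
    qPochInf (X ^ 2) (X ^ 4) * ∑' n : ℕ, (X : ℤ⟦X⟧) ^ (n ^ 2 + n) = qPochInf (X ^ 4) (X ^ 4) := by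
  have hX4 : (X : ℤ⟦X⟧) ∣ X ^ 4 := dvd_pow_self X (by norm_num)
  set D : ℕ → ℤ⟦X⟧ := fun n => qPochInf ((X ^ 2) ^ (2 * n + 1)) (X ^ 4) with hDdef
  have hD : ∀ n, D n = (1 - (X ^ 2) ^ (2 * n + 1)) * D (n + 1) := by
    intro n
    simp only [hDdef]
    rw [qPochInf_eq_mul_succ _ hX4]
    congr 2
    ring
  have hsum : ∀ n : ℕ, ∑ m ∈ Finset.range n,
      (((X : ℤ⟦X⟧) ^ 2) ^ (m * (2 * m + 1)) + (X ^ 2) ^ ((m + 1) * (2 * m + 1))) =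
      ∑ m ∈ Finset.range (2 * n), X ^ (m ^ 2 + m) := by
    intro n
    induction n with
    | zero => simp
    | succ n ih =>
      rw [Finset.sum_range_succ, ih, show 2 * (n + 1) = 2 * n + 1 + 1 by ring,
        Finset.sum_range_succ, Finset.sum_range_succ]
      ring
  have h0 : D 0 = qPochInf (X ^ 2) (X ^ 4) := by simp [hDdef]
  have hlim : Tendsto (fun n => D 0 * ∑ m ∈ Finset.range (2 * n), (X : ℤ⟦X⟧) ^ (m ^ 2 + m)) atTop
      (𝓝 (D 0 * ∑' n : ℕ, (X : ℤ⟦X⟧) ^ (n ^ 2 + n))) :=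
    (summable_X_pow_sq_add.hasSum.tendsto_sum_nat.comp
      (tendsto_id.const_mul_atTop' two_pos)).const_mul (D 0)
  rw [← h0]
  -- Shifting the index makes the Shanks sum nonempty. Its `k = 0` term carries the limit; all
  -- others are divisible by high powers of `X`.
  refine tendsto_nhds_unique hlim ((tendsto_add_atTop_iff_nat 1).mp ?_)
  refine tendsto_of_X_pow_dvd fun n => ?_
  rw [← hsum, ← sum_shanks (X ^ 2) D hD, Finset.sum_range_succ']
  have hp : ∏ j ∈ Finset.Ico 0 (n + 1), (1 - ((X : ℤ⟦X⟧) ^ 2) ^ (2 * j + 2)) =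
      qPoch (X ^ 4) (X ^ 4) (n + 1) := by
    rw [qPoch, Finset.range_eq_Ico]
    exact Finset.prod_congr rfl fun j _ => by ring
  rw [hp, qPochInf_eq_qPoch_mul (X ^ 4) hX4 (n + 1), add_sub_assoc]
  refine dvd_add (Finset.dvd_sum fun k _ => ?_) ?_
  · refine Dvd.dvd.mul_left ?_ _
    rw [← pow_mul]
    exact pow_dvd_pow X (show n ≤ 2 * ((k + 1) * (2 * (n + 1) + 1)) by nlinarith)
  · have e1 : (X : ℤ⟦X⟧) ^ n ∣ D (n + 1) - 1 := by
      refine X_pow_dvd_qPochInf_sub_one hX4 ?_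
      rw [← pow_mul]
      exact pow_dvd_pow _ (by omega)
    have e2 : (X : ℤ⟦X⟧) ^ n ∣ qPochInf (X ^ 4 * (X ^ 4) ^ (n + 1)) (X ^ 4) - 1 := by
      refine X_pow_dvd_qPochInf_sub_one hX4 (Dvd.dvd.mul_left ?_ _)
      rw [← pow_mul]
      exact pow_dvd_pow _ (by omega)
    convert (dvd_sub e1 e2).mul_left (qPoch (X ^ 4) (X ^ 4) (n + 1)) using 1
    simp [qPoch]
    ring

/-! ### A contiguous family of series deforming `v` into a theta series -/

/-- The tail `(q ^ (2 * j + 1); q ^ 2)_∞`. -/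
noncomputable def oddTail (j : ℕ) : ℤ⟦X⟧ := qPochInf (X ^ (2 * j + 1)) (X ^ 2)

/-- The tail `(-q ^ (2 * j + 1); q ^ 2)_∞`. -/
noncomputable def negOddTail (j : ℕ) : ℤ⟦X⟧ := qPochInf (-X ^ (2 * j + 1)) (X ^ 2)

/-- `q ^ (2 * N * n) * (-q ^ (1 - 2 * N); q ^ 2)_n * (-q ^ (2 * N + 1); q ^ 2)_∞`, written without
negative powers of `q`. -/
noncomputable def shiftedFactor (N n : ℕ) : ℤ⟦X⟧ :=
  (∏ k ∈ Finset.range n, (X ^ (2 * N) + X ^ (2 * k + 1))) * negOddTail N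

/-- The summands of the `N`-th series of the contiguous family. -/
noncomputable def contigTerm (N n : ℕ) : ℤ⟦X⟧ :=
  X ^ (n ^ 2 + 2 * n) * shiftedFactor N n * oddTail (N + n + 1)

/-- The `N`-th series of the contiguous family. -/
noncomputable def contigSum (N : ℕ) : ℤ⟦X⟧ := ∑' n, contigTerm N n

theorem X_dvd_X_sq : (X : ℤ⟦X⟧) ∣ X ^ 2 := dvd_pow_self X two_ne_zero

theorem X_dvd_X_pow_four : (X : ℤ⟦X⟧) ∣ X ^ 4 := dvd_pow_self X four_ne_zero

theorem oddTail_eq (j : ℕ) : oddTail j = (1 - X ^ (2 * j + 1)) * oddTail (j + 1) := by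
  rw [oddTail, qPochInf_eq_mul_succ _ X_dvd_X_sq, oddTail]
  ring_nf

theorem negOddTail_eq (j : ℕ) : negOddTail j = (1 + X ^ (2 * j + 1)) * negOddTail (j + 1) := by
  rw [negOddTail, qPochInf_eq_mul_succ _ X_dvd_X_sq, negOddTail, sub_neg_eq_add]
  ring_nf

theorem X_pow_dvd_oddTail_sub_one (j : ℕ) : X ^ (2 * j + 1) ∣ oddTail j - 1 :=
  X_pow_dvd_qPochInf_sub_one X_dvd_X_sq dvd_rfl

theorem X_pow_dvd_negOddTail_sub_one (j : ℕ) : X ^ (2 * j + 1) ∣ negOddTail j - 1 :=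
  X_pow_dvd_qPochInf_sub_one X_dvd_X_sq (dvd_neg.mpr dvd_rfl)

theorem rescale_oddTail (j : ℕ) : rescale (-1 : ℤ) (oddTail j) = negOddTail j := by
  rw [oddTail, map_qPochInf _ (continuous_rescale _) _ X_dvd_X_sq, negOddTail, map_pow, map_pow,
    rescale_neg_one_X, Even.neg_pow even_two, Odd.neg_pow ⟨j, rfl⟩]

theorem rescale_negOddTail (j : ℕ) : rescale (-1 : ℤ) (negOddTail j) = oddTail j := by
  rw [negOddTail, map_qPochInf _ (continuous_rescale _) _ X_dvd_X_sq, oddTail, map_neg, map_pow,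
    map_pow, rescale_neg_one_X, Even.neg_pow even_two, Odd.neg_pow ⟨j, rfl⟩, neg_neg]

theorem negOddTail_mul_oddTail_zero :
    negOddTail 0 * oddTail 0 = qPochInf (X ^ 2) (X ^ 4) := by
  rw [negOddTail, oddTail, qPochInf_neg_mul _ X_dvd_X_sq]
  ring_nf

theorem shiftedFactor_succ (N n : ℕ) :
    shiftedFactor N (n + 1) = (X ^ (2 * N) + X ^ (2 * n + 1)) * shiftedFactor N n := by
  rw [shiftedFactor, Finset.prod_range_succ, shiftedFactor]
  ring

/-- The `k = 0` factor is q (1 + q^(2N+1)), whose second factor completes the tail; each later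
factor gives up q². -/
theorem shiftedFactor_succ_succ (N n : ℕ) :
    shiftedFactor (N + 1) (n + 1) = X ^ (2 * n + 1) * shiftedFactor N n := by
  induction n with
  | zero =>
    simp only [shiftedFactor, zero_add, Finset.prod_range_one, Finset.prod_range_zero,
      negOddTail_eq N]
    ring
  | succ n ih =>
    rw [shiftedFactor_succ (N + 1) (n + 1), ih, shiftedFactor_succ N n]
    ring

/-- The antidifference relating consecutive series of the contiguous family. -/
noncomputable def contigCert (N n : ℕ) : ℤ⟦X⟧ :=
  -(X ^ (n ^ 2 + 2 * N + 1) * shiftedFactor (N + 1) n * oddTail (N + n + 1))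

theorem contigTerm_sub (N n : ℕ) :
    contigTerm N n - (1 + X ^ (4 * N + 4)) * contigTerm (N + 1) n =
      contigCert N (n + 1) - contigCert N n := by
  have h := shiftedFactor_succ_succ N n
  rw [shiftedFactor_succ] at h
  have hD := oddTail_eq (N + n + 1)
  -- The power q^(2n+1) is what lets `h` express `shiftedFactor N n` through `shiftedFactor (N + 1)
  -- n`.
  refine mul_left_cancel₀ (pow_ne_zero (2 * n + 1) (X_ne_zero (R := ℤ))) ?_
  simp only [contigTerm, contigCert, shiftedFactor_succ_succ N n]
  rw [show N + 1 + n + 1 = N + n + 1 + 1 by ring, show N + (n + 1) + 1 = N + n + 1 + 1 by ring, hD]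
  linear_combination (-X ^ (n ^ 2 + 2 * n) * oddTail (N + n + 1 + 1) *
    (1 - X ^ (2 * (N + n + 1) + 1) + X ^ (2 * n + 2 * N + 3))) * h

theorem summable_contigTerm (N : ℕ) : Summable (contigTerm N) :=
  summable_of_X_pow_dvd fun n => by
    rw [contigTerm, mul_assoc]
    exact (pow_dvd_pow X (by nlinarith : n ≤ n ^ 2 + 2 * n)).mul_right _

theorem tendsto_contigCert (N : ℕ) : Tendsto (contigCert N) atTop (𝓝 0) :=
  tendsto_of_X_pow_dvd fun n => by
    rw [sub_zero, contigCert, mul_assoc]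
    exact dvd_neg.mpr ((pow_dvd_pow X (by nlinarith : n ≤ n ^ 2 + 2 * N + 1)).mul_right _)

/-- Summing `contigTerm_sub` over `n` leaves only the boundary value `-contigCert N 0`. -/
theorem contigSum_eq (N : ℕ) : contigSum N = (1 + X ^ (4 * N + 4)) * contigSum (N + 1) +
    X ^ (2 * N + 1) * (negOddTail (N + 1) * oddTail (N + 1)) := by
  have h1 := ((summable_contigTerm N).hasSum.sub
    ((summable_contigTerm (N + 1)).hasSum.mul_left (1 + X ^ (4 * N + 4)))).tendsto_sum_nat
  simp only [contigTerm_sub, Finset.sum_range_sub] at h1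
  have h2 := tendsto_nhds_unique h1 ((tendsto_contigCert N).sub_const (contigCert N 0))
  rw [contigSum, contigSum, ← sub_eq_iff_eq_add', h2]
  simp [contigCert, shiftedFactor]
  ring

/-- Modulo q^N both tails are 1 and the product is q^(1+3+⋯+(2n-1)) = q^(n²). The bound is uniform
in `n`, so it passes to the sum. -/
theorem X_pow_dvd_contigTerm_sub (N n : ℕ) :
    (X : ℤ⟦X⟧) ^ N ∣ contigTerm N n - X ^ (2 * n ^ 2 + 2 * n) := by
  have hprod : (X : ℤ⟦X⟧) ^ N ∣
      ∏ k ∈ Finset.range n, (X ^ (2 * N) + X ^ (2 * k + 1)) - X ^ (n ^ 2) := by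
    induction n with
    | zero => simp
    | succ n ih =>
      rw [Finset.prod_range_succ]
      have h : (X : ℤ⟦X⟧) ^ N ∣ X ^ (2 * N) := pow_dvd_pow X (by omega)
      convert dvd_add (ih.mul_right (X ^ (2 * n + 1)))
        (h.mul_left (∏ k ∈ Finset.range n, (X ^ (2 * N) + X ^ (2 * k + 1)))) using 1
      ring
  have hE : (X : ℤ⟦X⟧) ^ N ∣ negOddTail N - 1 :=
    (pow_dvd_pow X (by omega)).trans (X_pow_dvd_negOddTail_sub_one N)
  have hD : (X : ℤ⟦X⟧) ^ N ∣ oddTail (N + n + 1) - 1 :=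
    (pow_dvd_pow X (by omega)).trans (X_pow_dvd_oddTail_sub_one (N + n + 1))
  rw [contigTerm, shiftedFactor]
  set P := ∏ k ∈ Finset.range n, ((X : ℤ⟦X⟧) ^ (2 * N) + X ^ (2 * k + 1))
  convert (dvd_add (dvd_add (hprod.mul_right 1) (hE.mul_left P))
    (hD.mul_left (P * negOddTail N))).mul_left (X ^ (n ^ 2 + 2 * n)) using 1
  ring

theorem summable_X_pow_two_mul_sq_add :
    Summable fun n : ℕ => (X : ℤ⟦X⟧) ^ (2 * n ^ 2 + 2 * n) :=
  summable_of_X_pow_dvd fun n => pow_dvd_pow X (by nlinarith)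

theorem X_pow_dvd_contigSum_sub (N : ℕ) :
    (X : ℤ⟦X⟧) ^ N ∣ contigSum N - ∑' n : ℕ, X ^ (2 * n ^ 2 + 2 * n) := by
  rw [contigSum, ← (summable_contigTerm N).tsum_sub summable_X_pow_two_mul_sq_add]
  exact X_pow_dvd_tsum ((summable_contigTerm N).sub summable_X_pow_two_mul_sq_add)
    (X_pow_dvd_contigTerm_sub N)

theorem rescale_tsum {f : ℕ → ℤ⟦X⟧} (hf : Summable f) (a : ℤ) :
    rescale a (∑' n, f n) = ∑' n, rescale a (f n) :=
  hf.map_tsum (rescale a) (continuous_rescale a)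

theorem contigSum_add_rescale_eq (N : ℕ) :
    contigSum N + rescale (-1 : ℤ) (contigSum N) =
      (1 + X ^ (4 * N + 4)) * (contigSum (N + 1) + rescale (-1 : ℤ) (contigSum (N + 1))) := by
  have h : rescale (-1 : ℤ) (contigSum N) =
      (1 + X ^ (4 * N + 4)) * rescale (-1 : ℤ) (contigSum (N + 1)) -
        X ^ (2 * N + 1) * (negOddTail (N + 1) * oddTail (N + 1)) := by
    rw [contigSum_eq N]
    simp only [map_add, map_mul, map_one, map_pow, rescale_oddTail, rescale_negOddTail,
      rescale_neg_one_X]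
    rw [Even.neg_pow ⟨2 * N + 2, by ring⟩, Odd.neg_pow ⟨N, rfl⟩]
    ring
  rw [h, contigSum_eq N]
  ring

theorem contigSum_zero_add_rescale (N : ℕ) :
    contigSum 0 + rescale (-1 : ℤ) (contigSum 0) =
      qPoch (-X ^ 4) (X ^ 4) N * (contigSum N + rescale (-1 : ℤ) (contigSum N)) := by
  induction N with
  | zero => simp [qPoch]
  | succ N ih =>
    rw [ih, contigSum_add_rescale_eq N, qPoch_succ]
    ring

theorem X_pow_dvd_rescale {f : ℤ⟦X⟧} {m : ℕ} (a : ℤ) (h : X ^ m ∣ f) : X ^ m ∣ rescale a f := by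
  rw [X_pow_dvd_iff] at h ⊢
  intro d hd
  rw [coeff_rescale, h d hd, mul_zero]

theorem contigSum_zero_add_rescale_eq_tsum :
    contigSum 0 + rescale (-1 : ℤ) (contigSum 0) =
      2 * (qPochInf (-X ^ 4) (X ^ 4) * ∑' n : ℕ, X ^ (2 * n ^ 2 + 2 * n)) := by
  refine eq_of_forall_X_pow_dvd_sub fun N => ?_
  set Θ : ℤ⟦X⟧ := ∑' n : ℕ, X ^ (2 * n ^ 2 + 2 * n) with hΘ
  have hΘ' : rescale (-1 : ℤ) Θ = Θ := by
    rw [hΘ, rescale_tsum summable_X_pow_two_mul_sq_add]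
    refine tsum_congr fun n => ?_
    rw [map_pow, rescale_neg_one_X, Even.neg_pow ⟨n ^ 2 + n, by ring⟩]
  have h1 := X_pow_dvd_contigSum_sub N
  have h2 := X_pow_dvd_rescale (-1) h1
  rw [← hΘ] at h1 h2
  rw [map_sub, hΘ'] at h2
  have h3 : (X : ℤ⟦X⟧) ^ N ∣ qPochInf (-X ^ 4 * (X ^ 4) ^ N) (X ^ 4) - 1 := by
    refine X_pow_dvd_qPochInf_sub_one X_dvd_X_pow_four (Dvd.dvd.mul_left ?_ _)
    rw [← pow_mul]
    exact pow_dvd_pow X (by omega)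
  rw [contigSum_zero_add_rescale N, qPochInf_eq_qPoch_mul _ X_dvd_X_pow_four N]
  convert (dvd_sub (dvd_add h1 h2) (h3.mul_left (2 * Θ))).mul_left
    (qPoch (-X ^ 4) (X ^ 4) N) using 1
  ring

/-! ### The odd part of `v` -/

theorem v_mul_tails : v * (negOddTail 0 * oddTail 0) = X * contigSum 0 := by
  rw [v, contigSum, ← summable_vTerm.tsum_mul_right, ← (summable_contigTerm 0).tsum_mul_left]
  refine tsum_congr fun n => ?_
  have hD : oddTail 0 = qPoch X (X ^ 2) (n + 1) * oddTail (n + 1) := by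
    rw [oddTail, qPochInf_eq_qPoch_mul _ X_dvd_X_sq (n + 1), oddTail]
    ring_nf
  have hr := mul_recip (constantCoeff_qPoch (n + 1))
  have hp : ∏ k ∈ Finset.range n, ((X : ℤ⟦X⟧) ^ (2 * 0) + X ^ (2 * k + 1)) =
      qPoch (-X) (X ^ 2) n :=
    Finset.prod_congr rfl fun k _ => by ring
  rw [vTerm, contigTerm, shiftedFactor, hp, hD, zero_add]
  linear_combination (X ^ ((n + 1) ^ 2) * qPoch (-X) (X ^ 2) n * negOddTail 0 *
    oddTail (n + 1)) * hr

theorem mk_Pv_mul : PowerSeries.mk (fun n => Pv (2 * n + 1)) * qPochInf X (X ^ 2) =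
    qPochInf (-X ^ 2) (X ^ 2) * ∑' n : ℕ, X ^ (n ^ 2 + n) := by
  apply expand_injective 2 two_ne_zero
  have hΘ : expand 2 two_ne_zero (∑' n : ℕ, (X : ℤ⟦X⟧) ^ (n ^ 2 + n)) =
      ∑' n : ℕ, X ^ (2 * n ^ 2 + 2 * n) := by
    rw [summable_X_pow_sq_add.map_tsum (expand 2 two_ne_zero) (continuous_expand 2 two_ne_zero)]
    refine tsum_congr fun n => ?_
    rw [map_pow, expand_X, ← pow_mul]
    ring
  rw [map_mul, map_mul, hΘ, expand_qPochInf _ _ _ X_dvd_X_sq, expand_qPochInf _ _ _ X_dvd_X_sq]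
  simp only [map_neg, map_pow, expand_X, ← pow_mul]
  norm_num only
  have hv := sub_rescale_neg_one v
  have h1 := v_mul_tails
  have h2 := congrArg (rescale (-1 : ℤ)) h1
  simp only [map_mul, rescale_oddTail, rescale_negOddTail, rescale_neg_one_X] at h2
  have h3 := contigSum_zero_add_rescale_eq_tsum
  rw [← negOddTail_mul_oddTail_zero]
  have h20 : (2 : ℤ⟦X⟧) ≠ 0 := fun h => by
    have := congrArg (constantCoeff (R := ℤ)) h
    rw [map_ofNat, map_zero] at this
    exact two_ne_zero this
  refine mul_left_cancel₀ (mul_ne_zero h20 X_ne_zero) ?_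
  simp only [Pv]
  -- The prefactor q is odd, so subtracting the q ↦ -q image of `h1` adds the two copies of
  -- `contigSum 0`.
  linear_combination (-negOddTail 0 * oddTail 0) * hv + h1 - h2 + X * h3

/-! ### Relations between ℓ_1, ℓ_2, ℓ_4 and the conclusion -/

theorem ell_one : ell 1 = qPochInf X (X ^ 2) * ell 2 := by
  rw [ell, ell, ← qPochInf_even_mul_odd _ (by simp), pow_one, pow_two]

theorem ell_two : ell 2 = qPochInf (X ^ 2) (X ^ 4) * ell 4 := by
  rw [ell, ell, ← qPochInf_even_mul_odd _ X_dvd_X_sq]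
  ring_nf

theorem ell_four : ell 4 = qPochInf (-X ^ 2) (X ^ 2) * ell 2 := by
  rw [ell, ell, qPochInf_neg_mul _ X_dvd_X_sq]
  ring_nf

end MockTheta

theorem theorem3p1 :
    PowerSeries.mk (fun n : ℕ => MockTheta.Pv (2 * n + 1)) =
      MockTheta.ell 4 ^ 3 * MockTheta.recip (MockTheta.ell 1 * MockTheta.ell 2) := by
  have hr := MockTheta.mul_recip (f := MockTheta.ell 1 * MockTheta.ell 2) (by
    rw [map_mul, MockTheta.constantCoeff_ell one_pos, MockTheta.constantCoeff_ell two_pos, mul_one])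
  have h1 := MockTheta.ell_one
  have h2 := MockTheta.ell_two
  have h4 := MockTheta.ell_four
  have hg : _ = MockTheta.ell 4 := MockTheta.qPochInf_mul_tsum_X_pow
  have hL := MockTheta.mk_Pv_mul
  set L := PowerSeries.mk (fun n : ℕ => MockTheta.Pv (2 * n + 1))
  set Θ : ℤ⟦X⟧ := ∑' n : ℕ, PowerSeries.X ^ (n ^ 2 + n)
  have key : L * (MockTheta.ell 1 * MockTheta.ell 2) = MockTheta.ell 4 ^ 3 := by
    calc L * (MockTheta.ell 1 * MockTheta.ell 2)
        = (MockTheta.qPochInf (-PowerSeries.X ^ 2) (PowerSeries.X ^ 2) * MockTheta.ell 2) *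
            Θ * MockTheta.ell 2 := by
          rw [h1]; linear_combination MockTheta.ell 2 ^ 2 * hL
      _ = MockTheta.ell 4 ^ 2 * (MockTheta.qPochInf (PowerSeries.X ^ 2) (PowerSeries.X ^ 4) * Θ) := by
          rw [← h4, h2]; ring
      _ = MockTheta.ell 4 ^ 3 := by rw [hg]; ring
  rw [← key, mul_assoc, hr, mul_one]
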